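/- Consider lattice walks that begin at the origin and take $n$ unit steps, each step East or North. For integers $0\le k<n$ and $r,s\ge 0$ with $r<s$, let $M_{r,s}^{n,k}$ be the number of unordered pairs of such walks, one ending at $(r,n-r)$ and the other at $(s,n-s)$, whose vertex sets have exactly $k$ points in common, not counting the starting point. For $r=s$ put $M_{r,r}^{n,k}=N_{k-1}^{n,r}$, where $N_m^{n,r}$ is the number of ordered pairs of such walks, both ending at $(r,n-r)$, whose vertex sets have exactly $m$ points in common, not counting the initial and terminal points (so $N_{-1}^{n,r}=0$). Then for all $0\le k<n$ and $0\le r\le s$ $$M_{r,s}^{n,k}=2\sum_{t\ge 0}\sum_{j\ge 0}(-1)^j\,\frac{s-j-r+1+2t}{n-1-j-2t}\binom{k}{2t+1}\binom{k-1-2t}{j}\binom{n-1-j-2t}{s-j}\binom{n-1-j-2t}{r-1-2t}+\frac{s-r}{n-k}\sum_{j\ge 0}\binom{k}{j}\binom{n-k}{r-j}\binom{n-k}{s-j},$$ where binomial coefficients with negative lower index are $0$ and the terms of the double sum with $\binom{k}{2t+1}\binom{k-1-2t}{j}=0$ are omitted. For $r<s$ the second expression (the one with the factor $\frac{s-r}{n-k}$)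 counts those of the pairs in which the two walks are at the same point after each of the first $k$ steps, and the first expression counts the remaining pairs. For $k=0$ the formula becomes $$M_{r,s}^{n,0}=\frac{s-r}{n}\binom{n}{r}\binom{n}{s}.$$ -/

import Mathlib

namespace LatticePairs

/-- A unit step: east or north. -/
inductive Step where
  | E : Step
  | N : Step
  deriving DecidableEq

instance : Fintype Step :=
  ⟨{Step.E, Step.N}, fun x => by cases x <;> simp⟩

/-- The displacement of a step. -/
def Step.vec : Step → ℤ × ℤ
  | Step.E => (1, 0)
  | Step.N => (0, 1)

/-- A walk of `n` unit steps, each east or north, beginning at the origin. -/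
abbrev Walk (n : ℕ) : Type := Fin n → Step

/-- The lattice point reached after the first `i` steps. -/
def Walk.pos {n : ℕ} (w : Walk n) (i : ℕ) : ℤ × ℤ :=
  ∑ j : Fin n with j.val < i, (w j).vec

/-- The lattice point at which the walk terminates. -/
def Walk.terminal {n : ℕ} (w : Walk n) : ℤ × ℤ := w.pos n

/-- The set of vertices of a walk, including its initial and terminal vertices. -/
def Walk.vertices {n : ℕ} (w : Walk n) : Finset (ℤ × ℤ) :=
  (Finset.range (n + 1)).image w.pos

/-- The number of points in which two walks intersect, not counting the starting point. -/
def meets {n : ℕ} (P Q : Walk n) : ℕ :=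
  ((P.vertices ∩ Q.vertices) \ {(0, 0)}).card

/-- The number of points in which two walks with the common terminal vertex `(r, n - r)` intersect,
not counting the initial and terminal vertices. -/
def interiorMeets {n : ℕ} (r : ℕ) (P Q : Walk n) : ℕ :=
  ((P.vertices ∩ Q.vertices) \ {(0, 0), ((r : ℤ), (n : ℤ) - r)}).card

/-- `N_k^{n,r}`: the number of ordered pairs of walks from the origin to `(r, n - r)` that
intersect in exactly `k` points, initial and terminal vertices excluded. -/
noncomputable def orderedCount (n k r : ℕ) : ℕ :=
  {p : Walk n × Walk n |
    p.1.terminal = ((r : ℤ), (n : ℤ) - r) ∧ p.2.terminal = ((r : ℤ), (n : ℤ) - r) ∧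
    interiorMeets r p.1 p.2 = k}.ncard

/-- The unordered pairs of walks from the origin, one to `(r, n - r)` and one to `(s, n - s)`,
that intersect in exactly `k` points, the starting point excluded, and that have the further
property `A` (where the first walk is the one ending at `(r, n - r)`). -/
def unorderedPairs (n k r s : ℕ) (A : Walk n → Walk n → Prop) : Set (Sym2 (Walk n)) :=
  {z | ∃ P Q : Walk n, z = s(P, Q) ∧
    P.terminal = ((r : ℤ), (n : ℤ) - r) ∧ Q.terminal = ((s : ℤ), (n : ℤ) - s) ∧
    meets P Q = k ∧ A P Q}

/-- `M_{r,s}^{n,k}` for `r ≤ s`. If `r < s` it counts unordered pairs; if `r = s` it is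
`N_{k-1}^{n,r}`, a count of ordered pairs, and `N_{-1}^{n,r} = 0`. -/
noncomputable def M (n k r s : ℕ) : ℕ :=
  if r = s then
    match k with
    | 0 => 0
    | k' + 1 => orderedCount n k' r
  else (unorderedPairs n k r s (fun _ _ => True)).ncard

/-- The two walks intersect in each of the first `k` steps: they are at the same point
after `i` steps, for every `1 ≤ i ≤ k`. -/
def MeetFirst {n : ℕ} (k : ℕ) (P Q : Walk n) : Prop :=
  ∀ i : ℕ, 1 ≤ i → i ≤ k → P.pos i = Q.pos i

/-- The binomial coefficient `C(a, b)` for integers, zero if `b < 0`. -/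
def binom (a b : ℤ) : ℚ :=
  if 0 ≤ b then ((Ring.choose a b.toNat : ℤ) : ℚ) else 0

/-- The double alternating sum. For `t > k` the factor `C(k, 2t+1)` is zero, and for `j > k` the
product `C(k, 2t+1) C(k-1-2t, j)` is zero, so the ranges carry all nonzero terms. -/
def firstExpr (n k r s : ℕ) : ℚ :=
  2 * ∑ t ∈ Finset.range (k + 1), ∑ j ∈ Finset.range (k + 1),
    (-1 : ℚ) ^ j * (((s : ℚ) - j - r + 1 + 2 * t) / ((n : ℚ) - 1 - j - 2 * t)) *
      binom k (2 * t + 1) * binom (k - 1 - 2 * t) j *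
      binom (n - 1 - j - 2 * t) (s - j) * binom (n - 1 - j - 2 * t) (r - 1 - 2 * t)

/-- The single sum; all its nonzero terms have `0 ≤ j ≤ k`. -/
def secondExpr (n k r s : ℕ) : ℚ :=
  ((s : ℚ) - r) / ((n : ℚ) - k) * ∑ j ∈ Finset.range (k + 1),
    binom k j * binom (n - k) (r - j) * binom (n - k) (s - j)

end LatticePairs

namespace LatticePairs

/-! Walks can share a point only at equal times, so pairs can be analysed by their last steps. Let
F_k(n,r,s) count ordered pairs with k meetings at positive times, where r ≤ s. If r < s, the last
step makes no meeting and F_k satisfies the four-term recursion over last steps. If r = s, it always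
makes one, and symmetry gives F_{k+1}(n,r,r) = F_k(n-1,r,r) + F_k(n-1,r-1,r-1) + 2 F_k(n-1,r-1,r).

Let D be `disjointPairs`, and S, V, C the shifts `straight`, `diverge`, `converge`. D satisfies the
four-term recursion for r < s and vanishes on the diagonal for n > 0, so (S+2V)^k D satisfies both
rules and equals F_k (`pairCount_meetTimes`). Without V, S^k D counts k common steps followed by a
disjoint pair (`pairCount_agreeTo`); its expansion is the second expression.

The first expression is the difference. With X = S+V it is ((X+V)^k - (X-V)^k) D, in which only odd
powers of V survive: this is the sum over t. As D = (S+V+C) D for n > 1, X^m D may be replaced by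
(1-C)^m D when n > m, which gives the alternating sum over j. -/

open Finset

/-! ### Meeting points and meeting times -/

/-- The abscissa of the point reached after `i` steps. -/
def Walk.east {n : ℕ} (w : Walk n) (i : ℕ) : ℤ := (w.pos i).1

/-- Extension of a walk by one step. -/
def Walk.extend {n : ℕ} (w : Walk n) (a : Step) : Walk (n + 1) :=
  Fin.snoc (α := fun _ => Step) w a

lemma Walk.pos_extend_of_le {n : ℕ} (w : Walk n) (a : Step) {i : ℕ} (hi : i ≤ n) :
    (w.extend a).pos i = w.pos i := by
  have : ¬ n < i := by omega
  simp [Walk.pos, Walk.extend, Finset.sum_filter, Fin.sum_univ_castSucc, this]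

lemma Walk.pos_extend_last {n : ℕ} (w : Walk n) (a : Step) :
    (w.extend a).pos (n + 1) = w.pos n + a.vec := by
  simp [Walk.pos, Walk.extend, Finset.sum_filter, Fin.sum_univ_castSucc]

lemma Walk.east_extend_of_le {n : ℕ} (w : Walk n) (a : Step) {i : ℕ} (hi : i ≤ n) :
    (w.extend a).east i = w.east i := by
  rw [Walk.east, w.pos_extend_of_le a hi, Walk.east]

lemma Walk.east_extend_last {n : ℕ} (w : Walk n) (a : Step) :
    (w.extend a).east (n + 1) = w.east n + a.vec.1 := by
  rw [Walk.east, w.pos_extend_last a, Walk.east, Prod.fst_add]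

/-- Every nonempty walk is uniquely a walk followed by a step. -/
def Walk.extendEquiv (n : ℕ) : Walk n × Step ≃ Walk (n + 1) where
  toFun p := p.1.extend p.2
  invFun w := (Fin.init (α := fun _ => Step) w, w (Fin.last n))
  left_inv p := by simp [Walk.extend]
  right_inv w := by simp [Walk.extend]

lemma Walk.pos_zero {n : ℕ} (w : Walk n) : w.pos 0 = 0 := by simp [Walk.pos]

lemma Walk.fst_add_snd_pos {n : ℕ} (w : Walk n) {i : ℕ} (hi : i ≤ n) :
    (w.pos i).1 + (w.pos i).2 = i := by
  have h : ∀ a : Step, a.vec.1 + a.vec.2 = 1 := by rintro (_ | _) <;> rfl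
  rw [Walk.pos, Prod.fst_sum, Prod.snd_sum, ← Finset.sum_add_distrib]
  simp only [h, Finset.sum_const, nsmul_eq_mul, mul_one]
  rw [Fin.card_filter_val_lt]
  simp [hi]

lemma Walk.pos_eq {n : ℕ} (w : Walk n) {i : ℕ} (hi : i ≤ n) :
    w.pos i = (w.east i, (i : ℤ) - w.east i) := by
  have := w.fst_add_snd_pos hi
  ext
  · rfl
  · simp only [Walk.east]; omega

lemma Walk.pos_eq_iff {n : ℕ} (P Q : Walk n) {i : ℕ} (hi : i ≤ n) :
    P.pos i = Q.pos i ↔ P.east i = Q.east i := by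
  rw [P.pos_eq hi, Q.pos_eq hi, Prod.mk.injEq]
  constructor
  · exact fun h => h.1
  · intro h; simp [h]

lemma Walk.terminal_eq_iff {n : ℕ} (w : Walk n) (r : ℤ) :
    w.terminal = (r, (n : ℤ) - r) ↔ w.east n = r := by
  rw [Walk.terminal, w.pos_eq le_rfl, Prod.mk.injEq]
  constructor
  · exact fun h => h.1
  · intro h; simp [h]

/-- The coordinate sum of a vertex is the time at which it is visited. -/
lemma Walk.time_unique {n : ℕ} (P Q : Walk n) {i j : ℕ} (hi : i ≤ n) (hj : j ≤ n)
    (h : P.pos i = Q.pos j) : i = j := by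
  have h1 := P.fst_add_snd_pos hi
  have h2 := Q.fst_add_snd_pos hj
  rw [h] at h1
  exact_mod_cast h1.symm.trans h2

/-- The number of positive times at which two walks are at the same point. -/
def meetTimes {n : ℕ} (P Q : Walk n) : ℕ :=
  #{i ∈ Icc 1 n | P.east i = Q.east i}

lemma vertices_inter_sdiff {n : ℕ} (P Q : Walk n) :
    (P.vertices ∩ Q.vertices) \ {(0, 0)} =
      {i ∈ Icc 1 n | P.east i = Q.east i}.image P.pos := by
  ext p
  simp only [Walk.vertices, mem_sdiff, mem_inter, mem_image, mem_range, mem_singleton,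
    mem_filter, mem_Icc]
  constructor
  · rintro ⟨⟨⟨i, hi, rfl⟩, ⟨j, hj, hij⟩⟩, h0⟩
    obtain rfl := Q.time_unique P (by omega) (by omega) hij
    refine ⟨j, ⟨⟨?_, by omega⟩, ?_⟩, rfl⟩
    · rcases Nat.eq_zero_or_pos j with rfl | h
      · exact absurd P.pos_zero h0
      · exact h
    · exact ((P.pos_eq_iff Q (by omega)).1 hij.symm)
  · rintro ⟨i, ⟨⟨hi, hin⟩, h⟩, rfl⟩
    refine ⟨⟨⟨i, by omega, rfl⟩, ⟨i, by omega, ((P.pos_eq_iff Q hin).2 h).symm⟩⟩, ?_⟩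
    intro h0
    have := P.time_unique P (i := i) (j := 0) hin (by omega) (by rw [h0, P.pos_zero]; rfl)
    omega

lemma meets_eq_meetTimes {n : ℕ} (P Q : Walk n) : meets P Q = meetTimes P Q := by
  rw [meets, vertices_inter_sdiff, card_image_of_injOn, meetTimes]
  intro i hi j hj h
  simp only [coe_filter, mem_Icc, Set.mem_ofPred_eq] at hi hj
  exact P.time_unique P hi.1.2 hj.1.2 h

lemma interiorMeets_add_one {n r : ℕ} (hn : 0 < n) (P Q : Walk n)
    (hP : P.east n = r) (hQ : Q.east n = r) :
    interiorMeets r P Q + 1 = meetTimes P Q := by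
  rw [← meets_eq_meetTimes, meets, interiorMeets]
  have h : (P.vertices ∩ Q.vertices) \ {(0, 0), ((r : ℤ), (n : ℤ) - r)} =
      ((P.vertices ∩ Q.vertices) \ {(0, 0)}).erase ((r : ℤ), (n : ℤ) - r) := by
    ext p; simp; tauto
  rw [h, card_erase_add_one]
  rw [vertices_inter_sdiff, mem_image]
  refine ⟨n, ?_, ?_⟩
  · simp [hP, hQ]; omega
  · rw [P.pos_eq le_rfl, hP]

lemma meetTimes_extend {n : ℕ} (P Q : Walk n) (a b : Step) :
    meetTimes (P.extend a) (Q.extend b) =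
      meetTimes P Q + if P.east n + a.vec.1 = Q.east n + b.vec.1 then 1 else 0 := by
  rw [meetTimes, ← insert_Icc_right_eq_Icc_add_one (by omega), filter_insert,
    Walk.east_extend_last, Walk.east_extend_last]
  have h : {i ∈ Icc 1 n | (P.extend a).east i = (Q.extend b).east i} =
      {i ∈ Icc 1 n | P.east i = Q.east i} := by
    apply filter_congr
    intro i hi
    rw [mem_Icc] at hi
    rw [P.east_extend_of_le a hi.2, Q.east_extend_of_le b hi.2]
  split_ifs with h1
  · rw [card_insert_of_notMem (by simp), h, meetTimes]
  · rw [h, meetTimes, add_zero]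

/-! ### Ordered pairs and their last steps -/

open scoped Classical in
/-- The number of ordered pairs of walks of length `n` with property `A` that end at the
abscissas `r` and `s`. -/
noncomputable def pairCount (n : ℕ) (A : Walk n → Walk n → Prop) (r s : ℤ) : ℕ :=
  #{p : Walk n × Walk n | (p.1.east n = r ∧ p.2.east n = s) ∧ A p.1 p.2}

lemma pairCount_congr {n : ℕ} {A B : Walk n → Walk n → Prop} {r s : ℤ}
    (h : ∀ P Q : Walk n, P.east n = r → Q.east n = s → (A P Q ↔ B P Q)) :
    pairCount n A r s = pairCount n B r s := by
  classical
  unfold pairCount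
  congr 1
  apply filter_congr
  rintro ⟨P, Q⟩ -
  exact and_congr_right fun hp => h P Q hp.1 hp.2

lemma pairCount_eq_zero {n : ℕ} {A : Walk n → Walk n → Prop} {r s : ℤ}
    (h : ∀ P Q : Walk n, P.east n = r → Q.east n = s → ¬ A P Q) :
    pairCount n A r s = 0 := by
  classical
  rw [pairCount, card_eq_zero, filter_eq_empty_iff]
  rintro ⟨P, Q⟩ - ⟨hp, hA⟩
  exact h P Q hp.1 hp.2 hA

lemma pairCount_swap (n : ℕ) (A : Walk n → Walk n → Prop) (r s : ℤ) :
    pairCount n A r s = pairCount n (fun P Q => A Q P) s r := by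
  classical
  unfold pairCount
  refine card_bij (fun p _ => p.swap) ?_ (fun _ _ _ _ h => Prod.swap_injective h) ?_
  · rintro ⟨P, Q⟩ h; simp at h ⊢; tauto
  · rintro ⟨P, Q⟩ h; exact ⟨(Q, P), by simp at h ⊢; tauto, rfl⟩

lemma pairCount_zero (A : Walk 0 → Walk 0 → Prop) (hA : ∀ P Q, A P Q) (r s : ℤ) :
    pairCount 0 A r s = if r = 0 ∧ s = 0 then 1 else 0 := by
  classical
  have h : ∀ w : Walk 0, w.east 0 = 0 := fun w => by rw [Walk.east, w.pos_zero]; rfl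
  unfold pairCount
  simp only [h, hA, and_true]
  split_ifs with h1
  · rw [filter_true_of_mem (fun _ _ => ⟨h1.1.symm, h1.2.symm⟩)]; simp
  · rw [filter_false_of_mem (fun _ _ h2 => h1 ⟨h2.1.symm, h2.2.symm⟩)]; simp

lemma pairCount_succ (n : ℕ) (A : Walk (n + 1) → Walk (n + 1) → Prop) (r s : ℤ) :
    pairCount (n + 1) A r s = ∑ c : Step × Step,
      pairCount n (fun P Q => A (P.extend c.1) (Q.extend c.2)) (r - c.1.vec.1) (s - c.2.vec.1) := by
  classical
  unfold pairCount
  simp only [card_filter]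
  rw [← Finset.sum_product' (s := univ) (t := univ) (f := fun (c : Step × Step) (p : Walk n × Walk n) =>
    if (p.1.east n = r - c.1.vec.1 ∧ p.2.east n = s - c.2.vec.1) ∧
      A (p.1.extend c.1) (p.2.extend c.2) then 1 else 0), univ_product_univ]
  symm
  refine Fintype.sum_equiv (((Equiv.prodComm _ _).trans (Equiv.prodProdProdComm _ _ _ _)).trans
    ((Walk.extendEquiv n).prodCongr (Walk.extendEquiv n))) _ _ ?_
  rintro ⟨⟨a, b⟩, ⟨P, Q⟩⟩
  simp [Walk.extendEquiv, Walk.east_extend_last, eq_sub_iff_add_eq]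

lemma pairCount_succ' (n : ℕ) (A : Walk (n + 1) → Walk (n + 1) → Prop) (r s : ℤ) :
    pairCount (n + 1) A r s =
      pairCount n (fun P Q => A (P.extend .N) (Q.extend .N)) r s +
      pairCount n (fun P Q => A (P.extend .E) (Q.extend .E)) (r - 1) (s - 1) +
      pairCount n (fun P Q => A (P.extend .E) (Q.extend .N)) (r - 1) s +
      pairCount n (fun P Q => A (P.extend .N) (Q.extend .E)) r (s - 1) := by
  have hu : (univ : Finset Step) = {Step.E, Step.N} := rfl
  rw [pairCount_succ, Fintype.sum_prod_type, hu]
  simp [Step.vec]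
  ring

/-! ### The closed form for disjoint pairs -/

lemma binom_natCast (n m : ℕ) : binom n m = n.choose m := by
  simp [binom, Ring.choose_natCast]

lemma binom_of_neg (a : ℤ) {b : ℤ} (hb : b < 0) : binom a b = 0 := by
  rw [binom, if_neg (by omega)]

lemma binom_succ (n : ℕ) (r : ℤ) :
    binom (n + 1 : ℕ) r = binom n r + binom n (r - 1) := by
  rcases lt_or_ge r 0 with h | h
  · rw [binom_of_neg _ h, binom_of_neg _ h, binom_of_neg _ (by omega), add_zero]
  · lift r to ℕ using h
    rcases r with _ | r
    · rw [binom_of_neg _ (b := ((0 : ℕ) : ℤ) - 1) (by simp), binom_natCast, binom_natCast]; simp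
    · rw [show ((r + 1 : ℕ) : ℤ) - 1 = r by simp, binom_natCast, binom_natCast, binom_natCast,
        Nat.choose_succ_succ]
      push_cast; ring

lemma mul_binom_succ (n : ℕ) (r : ℤ) :
    (r : ℚ) * binom (n + 1 : ℕ) r = (n + 1) * binom n (r - 1) := by
  rcases lt_or_ge r 0 with h | h
  · rw [binom_of_neg _ h, binom_of_neg _ (by omega)]; simp
  · lift r to ℕ using h
    rcases r with _ | r
    · rw [binom_of_neg _ (b := ((0 : ℕ) : ℤ) - 1) (by simp)]; simp
    · rw [show ((r + 1 : ℕ) : ℤ) - 1 = r by simp, binom_natCast, binom_natCast]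
      have := Nat.add_one_mul_choose_eq n r
      have h : ((n + 1 : ℕ) : ℚ) * n.choose r = (n + 1).choose (r + 1) * (r + 1 : ℕ) := by
        exact_mod_cast this
      push_cast at h ⊢
      linarith

/-- The closed form for the number of pairs of walks of length `n` ending at the abscissas `r < s`
that meet only at the origin; the triple is `(n, r, s)`. -/
def disjointPairs (p : ℤ × ℤ × ℤ) : ℚ :=
  if 0 < p.1 then ((p.2.2 : ℚ) - p.2.1) / p.1 * binom p.1 p.2.1 * binom p.1 p.2.2
  else if p = 0 then 1 else 0

lemma disjointPairs_of_pos {n : ℤ} (hn : 0 < n) (r s : ℤ) :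
    disjointPairs (n, r, s) = ((s : ℚ) - r) / n * binom n r * binom n s := by
  simp [disjointPairs, hn]

lemma disjointPairs_of_neg {n : ℤ} (hn : n < 0) (r s : ℤ) : disjointPairs (n, r, s) = 0 := by
  have h1 : ¬ 0 < n := by omega
  have h2 : n ≠ 0 := by omega
  simp [disjointPairs, h1, h2]

lemma disjointPairs_zero (r s : ℤ) :
    disjointPairs (0, r, s) = if r = 0 ∧ s = 0 then 1 else 0 := by
  simp [disjointPairs]

lemma disjointPairs_diag {n : ℤ} (hn : 0 < n) (r : ℤ) : disjointPairs (n, r, r) = 0 := by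
  rw [disjointPairs_of_pos hn]; simp

/-- Recursion by the last step, away from the origin. -/
lemma disjointPairs_pascal {n : ℤ} (hn : 1 < n) (r s : ℤ) :
    disjointPairs (n, r, s) = disjointPairs (n - 1, r, s) + disjointPairs (n - 1, r - 1, s - 1) +
      disjointPairs (n - 1, r - 1, s) + disjointPairs (n - 1, r, s - 1) := by
  obtain ⟨m, rfl⟩ : ∃ m : ℕ, n = ((m + 1 : ℕ) : ℤ) := ⟨(n - 1).toNat, by omega⟩
  have hm : (0 : ℤ) < m := by push_cast at hn; omega
  rw [show ((m + 1 : ℕ) : ℤ) - 1 = m by simp]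
  simp only [disjointPairs_of_pos hm, disjointPairs_of_pos (show (0 : ℤ) < (m + 1 : ℕ) by omega)]
  -- Both sides reduce to products of binomials of row m; the absorption identity for r and for s
  -- removes the terms left by the shifted factors s - r ± 1.
  have h1 := mul_binom_succ m r
  have h2 := mul_binom_succ m s
  rw [binom_succ] at h1 h2 ⊢
  rw [binom_succ]
  have hm0 : (m : ℚ) ≠ 0 := by
    have : m ≠ 0 := by omega
    exact_mod_cast this
  have hm1 : (m : ℚ) + 1 ≠ 0 := by positivity
  push_cast
  field_simp
  linear_combination (-(binom m s + binom m (s - 1))) * -h1 - (binom m r + binom m (r - 1)) * h2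

/-- Recursion by the last step, valid for every length when the endpoints differ. -/
lemma disjointPairs_pascal_of_lt (n : ℤ) {r s : ℤ} (hrs : r < s) :
    disjointPairs (n, r, s) = disjointPairs (n - 1, r, s) + disjointPairs (n - 1, r - 1, s - 1) +
      disjointPairs (n - 1, r - 1, s) + disjointPairs (n - 1, r, s - 1) := by
  rcases lt_trichotomy n 1 with h | rfl | h
  · have h1 : n - 1 < 0 := by omega
    simp only [disjointPairs_of_neg h1, add_zero]
    rcases lt_or_eq_of_le (show n ≤ 0 by omega) with h0 | rfl
    · exact disjointPairs_of_neg h0 r s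
    · rw [disjointPairs_zero, if_neg (by omega)]
  -- At n = 1 the right side is made of the point mass at length 0; only (r, s) = (0, 1)
  -- contributes. On the diagonal the identity would fail here.
  · have hb : ∀ x : ℤ, binom 1 x = if x = 0 ∨ x = 1 then 1 else 0 := by
      intro x
      have := binom_succ 0 x
      have h0 : ∀ y : ℤ, binom (0 : ℕ) y = if y = 0 then 1 else 0 := by
        intro y
        rcases lt_or_ge y 0 with h | h
        · rw [binom_of_neg _ h, if_neg (by omega)]
        · lift y to ℕ using h
          rw [binom_natCast]
          rcases y with _ | y
          · simp
          · rw [if_neg (by omega)]; simp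
      rw [h0, h0] at this
      rw [show (1 : ℤ) = ((0 + 1 : ℕ) : ℤ) by simp, this]
      push_cast
      split_ifs <;> first | omega | simp
    rw [disjointPairs_of_pos one_pos, hb, hb]
    simp only [sub_self, disjointPairs_zero]
    by_cases hr : r = 0 ∧ s = 1
    · obtain ⟨rfl, rfl⟩ := hr; norm_num
    · split_ifs <;> first | omega | simp
  · exact disjointPairs_pascal h r s

/-! ### Shift operators and powers of `meetOp` -/

/-- The operator that translates a function by `v`. -/
def shift (v : ℤ × ℤ × ℤ) : Module.End ℚ (ℤ × ℤ × ℤ → ℚ) :=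
  LinearMap.funLeft ℚ ℚ (fun p => p - v)

@[simp] lemma shift_apply (v : ℤ × ℤ × ℤ) (f : ℤ × ℤ × ℤ → ℚ) (p : ℤ × ℤ × ℤ) :
    shift v f p = f (p - v) := rfl

lemma shift_mul_shift (v w : ℤ × ℤ × ℤ) : shift v * shift w = shift (v + w) := by
  ext f p
  simp [sub_sub]

lemma shift_pow (v : ℤ × ℤ × ℤ) (j : ℕ) : shift v ^ j = shift (j • v) := by
  induction j with
  | zero => ext f p; simp
  | succ j ih => rw [pow_succ, ih, shift_mul_shift, succ_nsmul]

lemma shift_commute (v w : ℤ × ℤ × ℤ) : Commute (shift v) (shift w) := by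
  rw [Commute, SemiconjBy, shift_mul_shift, shift_mul_shift, add_comm]

/-- A common last step. -/
def straight : Module.End ℚ (ℤ × ℤ × ℤ → ℚ) := shift (1, 0, 0) + shift (1, 1, 1)

/-- A last step that pulls the two walks together. -/
def converge : Module.End ℚ (ℤ × ℤ × ℤ → ℚ) := shift (1, 0, 1)

/-- A last step that drives the two walks apart, read backwards. -/
def diverge : Module.End ℚ (ℤ × ℤ × ℤ → ℚ) := shift (1, 1, 0)

lemma straight_commute_diverge : Commute straight diverge :=
  (shift_commute _ _).add_left (shift_commute _ _)

lemma converge_commute_diverge : Commute converge diverge := shift_commute _ _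

lemma straight_commute_converge : Commute straight converge :=
  (shift_commute _ _).add_left (shift_commute _ _)

/-- The operator that adds one meeting point, where an excursion is counted with weight `c`. -/
def meetOp (c : ℚ) : Module.End ℚ (ℤ × ℤ × ℤ → ℚ) := straight + c • diverge

lemma meetOp_apply (c : ℚ) (f : ℤ × ℤ × ℤ → ℚ) (n r s : ℤ) :
    meetOp c f (n, r, s) =
      f (n - 1, r, s) + f (n - 1, r - 1, s - 1) + c * f (n - 1, r - 1, s) := by
  simp [meetOp, straight, diverge]

lemma meetOp_pow_succ_apply (c : ℚ) (k : ℕ) (n r s : ℤ) :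
    (meetOp c ^ (k + 1)) disjointPairs (n, r, s) =
      (meetOp c ^ k) disjointPairs (n - 1, r, s) +
      (meetOp c ^ k) disjointPairs (n - 1, r - 1, s - 1) +
      c * (meetOp c ^ k) disjointPairs (n - 1, r - 1, s) := by
  rw [pow_succ', Module.End.mul_apply, meetOp_apply]

/-- The shifts in `meetOp` never widen the gap but may close it by one, so the inductive hypothesis
is needed for a gap s - r + 1 as well, which is still positive. -/
lemma meetOp_pow_pascal (c : ℚ) (k : ℕ) (n : ℤ) {r s : ℤ} (hrs : r < s) :
    (meetOp c ^ k) disjointPairs (n, r, s) =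
      (meetOp c ^ k) disjointPairs (n - 1, r, s) +
      (meetOp c ^ k) disjointPairs (n - 1, r - 1, s - 1) +
      (meetOp c ^ k) disjointPairs (n - 1, r - 1, s) +
      (meetOp c ^ k) disjointPairs (n - 1, r, s - 1) := by
  induction k generalizing n r s with
  | zero => simpa using disjointPairs_pascal_of_lt n hrs
  | succ k ih =>
    simp only [meetOp_pow_succ_apply]
    rw [ih (n - 1) hrs, ih (n - 1) (show r - 1 < s - 1 by omega),
      ih (n - 1) (show r - 1 < s by omega)]
    ring

lemma meetOp_pow_of_lt (c : ℚ) {k : ℕ} {n : ℤ} (h : n < k) (r s : ℤ) :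
    (meetOp c ^ k) disjointPairs (n, r, s) = 0 := by
  induction k generalizing n r s with
  | zero => exact disjointPairs_of_neg (by simpa using h) r s
  | succ k ih =>
    have h1 : n - 1 < k := by push_cast at h; omega
    simp [meetOp_pow_succ_apply, ih h1]

lemma meetOp_pow_eq_length (c : ℚ) (k : ℕ) {r s : ℤ} (hrs : r < s) :
    (meetOp c ^ k) disjointPairs (k, r, s) = 0 := by
  induction k generalizing r s with
  | zero => simp [disjointPairs_zero]; omega
  | succ k ih =>
    simp only [meetOp_pow_succ_apply]
    rw [show ((k + 1 : ℕ) : ℤ) - 1 = k by simp, ih hrs, ih (by omega), ih (by omega)]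
    simp

/-- For c = 0 the operator preserves the diagonal, where D vanishes at positive length. -/
lemma meetOp_zero_pow_diag {k : ℕ} {n : ℤ} (h : k < n) (r : ℤ) :
    (meetOp 0 ^ k) disjointPairs (n, r, r) = 0 := by
  induction k generalizing n r with
  | zero => exact disjointPairs_diag (by simpa using h) r
  | succ k ih =>
    have h1 : (k : ℤ) < n - 1 := by push_cast at h; omega
    simp [meetOp_pow_succ_apply, ih h1]

/-! ### Counting pairs by the number of meeting points -/

/-- For r < s all four predecessors still lie in the region r ≤ s, so induction on the length stays
inside it. -/
lemma pairCount_meetTimes (n k : ℕ) {r s : ℤ} (hrs : r ≤ s) :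
    (pairCount n (fun P Q => meetTimes P Q = k) r s : ℚ) =
      (meetOp 2 ^ k) disjointPairs (n, r, s) := by
  induction n generalizing k r s with
  | zero =>
    rcases k with _ | k
    · rw [pairCount_zero _ (fun P Q => by simp [meetTimes])]
      simp [disjointPairs_zero]
    · rw [pairCount_eq_zero (fun P Q _ _ => by simp [meetTimes]),
        meetOp_pow_of_lt _ (by push_cast; omega)]
      simp
  | succ n ih =>
    have hn : ((n + 1 : ℕ) : ℤ) - 1 = n := by simp
    rcases lt_or_eq_of_le hrs with h | rfl
    · rw [meetOp_pow_pascal 2 k _ h, hn, ← ih k h.le, ← ih k (show r - 1 ≤ s - 1 by omega),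
        ← ih k (show r - 1 ≤ s by omega), ← ih k (show r ≤ s - 1 by omega), pairCount_succ']
      push_cast
      congr 1
      · congr 1
        · congr 1
          all_goals
            congr 1
            apply pairCount_congr
            intro P Q hP hQ
            rw [meetTimes_extend, hP, hQ, if_neg (by simp [Step.vec]; omega), add_zero]
        · congr 1
          apply pairCount_congr
          intro P Q hP hQ
          rw [meetTimes_extend, hP, hQ, if_neg (by simp [Step.vec]; omega), add_zero]
      · congr 1
        apply pairCount_congr
        intro P Q hP hQ
        rw [meetTimes_extend, hP, hQ, if_neg (by simp [Step.vec]; omega), add_zero]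
    · rcases k with _ | k
      · rw [pairCount_eq_zero, pow_zero, Module.End.one_apply,
          disjointPairs_diag (by push_cast; omega), Nat.cast_zero]
        intro P Q hP hQ h
        rw [meetTimes, card_eq_zero, filter_eq_empty_iff] at h
        exact h (x := n + 1) (by simp) (hP.trans hQ.symm)
      · have key : ∀ a b : Step, ∀ x y : ℤ, x + a.vec.1 = y + b.vec.1 →
            pairCount n (fun P Q => meetTimes (P.extend a) (Q.extend b) = k + 1) x y =
              pairCount n (fun P Q => meetTimes P Q = k) x y := by
          intro a b x y hxy
          apply pairCount_congr
          intro P Q hP hQ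
          rw [meetTimes_extend, hP, hQ, if_pos hxy]
          omega
        -- The predecessor (r, r - 1) lies outside the region; exchanging the walks brings it back
        -- and produces the weight 2.
        have sym : pairCount n (fun P Q => meetTimes P Q = k) r (r - 1) =
            pairCount n (fun P Q => meetTimes P Q = k) (r - 1) r := by
          rw [pairCount_swap]
          simp only [meetTimes, eq_comm]
        rw [meetOp_pow_succ_apply, hn, ← ih k le_rfl, ← ih k le_rfl,
          ← ih k (show r - 1 ≤ r by omega), pairCount_succ', key _ _ _ _ rfl, key _ _ _ _ rfl,
          key _ _ _ _ (by simp [Step.vec]), key _ _ _ _ (by simp [Step.vec]), sym]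
        push_cast
        ring

/-- The walks have the same abscissa at all positive times up to `k`. -/
def AgreeTo {n : ℕ} (k : ℕ) (P Q : Walk n) : Prop :=
  ∀ i : ℕ, 1 ≤ i → i ≤ k → P.east i = Q.east i

lemma agreeTo_extend {n k : ℕ} (hk : k ≤ n) (P Q : Walk n) (a b : Step) :
    AgreeTo k (P.extend a) (Q.extend b) ↔ AgreeTo k P Q := by
  refine forall_congr' fun i => forall_congr' fun _ => forall_congr' fun hi => ?_
  rw [P.east_extend_of_le a (hi.trans hk), Q.east_extend_of_le b (hi.trans hk)]

lemma AgreeTo.le_meetTimes {n k : ℕ} {P Q : Walk n} (h : AgreeTo k P Q) (hk : k ≤ n) :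
    k ≤ meetTimes P Q := by
  have : Icc 1 k ⊆ {i ∈ Icc 1 n | P.east i = Q.east i} := by
    intro i hi
    rw [mem_Icc] at hi
    rw [mem_filter, mem_Icc]
    exact ⟨⟨hi.1, hi.2.trans hk⟩, h i hi.1 hi.2⟩
  simpa [meetTimes] using card_le_card this

lemma agreeTo_succ {n k : ℕ} {P Q : Walk n} :
    AgreeTo (k + 1) P Q ↔ AgreeTo k P Q ∧ P.east (k + 1) = Q.east (k + 1) := by
  constructor
  · exact fun h => ⟨fun i h1 h2 => h i h1 (by omega), h _ (by omega) le_rfl⟩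
  · rintro ⟨h, h'⟩ i h1 h2
    rcases Nat.lt_or_ge k i with hi | hi
    · obtain rfl : i = k + 1 := by omega
      exact h'
    · exact h i h1 hi

lemma pairCount_agreeTo {n k : ℕ} (hk : k ≤ n) {r s : ℤ} (hrs : r ≤ s) :
    (pairCount n (fun P Q => meetTimes P Q = k ∧ AgreeTo k P Q) r s : ℚ) =
      (meetOp 0 ^ k) disjointPairs (n, r, s) := by
  induction n generalizing k r s with
  | zero =>
    obtain rfl : k = 0 := by omega
    rw [pairCount_zero _ (fun P Q => ⟨by simp [meetTimes], fun i h1 h2 => by omega⟩)]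
    simp [disjointPairs_zero]
  | succ n ih =>
    have hn : ((n + 1 : ℕ) : ℤ) - 1 = n := by simp
    rcases Nat.lt_or_ge n k with hkn | hkn
    -- Agreement lasts for the whole walk, so only the diagonal can contribute, and only through
    -- common last steps.
    · obtain rfl : k = n + 1 := by omega
      rcases lt_or_eq_of_le hrs with h | rfl
      · rw [meetOp_pow_eq_length _ _ h, pairCount_eq_zero, Nat.cast_zero]
        rintro P Q hP hQ ⟨-, hA⟩
        have := hA (n + 1) (by omega) le_rfl
        omega
      · have key : ∀ a b : Step, ∀ x y : ℤ, x + a.vec.1 = y + b.vec.1 →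
            pairCount n (fun P Q => meetTimes (P.extend a) (Q.extend b) = n + 1 ∧
              AgreeTo (n + 1) (P.extend a) (Q.extend b)) x y =
              pairCount n (fun P Q => meetTimes P Q = n ∧ AgreeTo n P Q) x y := by
          intro a b x y hxy
          apply pairCount_congr
          intro P Q hP hQ
          rw [meetTimes_extend, agreeTo_succ, agreeTo_extend le_rfl, Walk.east_extend_last,
            Walk.east_extend_last, hP, hQ, if_pos hxy]
          simp [hxy]
        have h1 : pairCount n (fun P Q => meetTimes P Q = n ∧ AgreeTo n P Q) r (r - 1) =
            pairCount n (fun P Q => meetTimes P Q = n ∧ AgreeTo n P Q) (r - 1) r := by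
          rw [pairCount_swap]
          simp only [meetTimes, AgreeTo, eq_comm]
        have h2 : (pairCount n (fun P Q => meetTimes P Q = n ∧ AgreeTo n P Q) (r - 1) r : ℚ)
            = 0 := by
          rw [ih le_rfl (by omega), meetOp_pow_eq_length _ _ (by omega)]
        rw [meetOp_pow_succ_apply, hn, ← ih le_rfl le_rfl, ← ih le_rfl le_rfl, pairCount_succ',
          key _ _ _ _ rfl, key _ _ _ _ rfl, key _ _ _ _ (by simp [Step.vec]),
          key _ _ _ _ (by simp [Step.vec]), h1]
        push_cast
        rw [h2]
        ring
    · rcases lt_or_eq_of_le hrs with h | rfl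
      · have key : ∀ a b : Step, ∀ x y : ℤ, x + a.vec.1 ≠ y + b.vec.1 →
            pairCount n (fun P Q => meetTimes (P.extend a) (Q.extend b) = k ∧
              AgreeTo k (P.extend a) (Q.extend b)) x y =
              pairCount n (fun P Q => meetTimes P Q = k ∧ AgreeTo k P Q) x y := by
          intro a b x y hxy
          apply pairCount_congr
          intro P Q hP hQ
          rw [meetTimes_extend, agreeTo_extend hkn, hP, hQ, if_neg hxy, add_zero]
        rw [meetOp_pow_pascal 0 k _ h, hn, ← ih hkn h.le,
          ← ih hkn (show r - 1 ≤ s - 1 by omega), ← ih hkn (show r - 1 ≤ s by omega),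
          ← ih hkn (show r ≤ s - 1 by omega), pairCount_succ',
          key _ _ _ _ (by simp [Step.vec]; omega), key _ _ _ _ (by simp [Step.vec]; omega),
          key _ _ _ _ (by simp [Step.vec]; omega), key _ _ _ _ (by simp [Step.vec]; omega)]
        push_cast
        ring
      -- Agreement up to k, with k at most n, already gives k meetings; the common endpoint would be
      -- one more.
      · rw [meetOp_zero_pow_diag (by push_cast; omega), pairCount_eq_zero, Nat.cast_zero]
        rintro P Q hP hQ ⟨hm, hA⟩
        have hP' : AgreeTo k (Fin.init (α := fun _ => Step) P : Walk n)
            (Fin.init (α := fun _ => Step) Q) := by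
          rw [← agreeTo_extend hkn _ _ (P (Fin.last n)) (Q (Fin.last n))]
          simpa [Walk.extend] using hA
        have h1 := hP'.le_meetTimes hkn
        have h2 := meetTimes_extend (Fin.init (α := fun _ => Step) P : Walk n)
            (Fin.init (α := fun _ => Step) Q) (P (Fin.last n)) (Q (Fin.last n))
        rw [← Walk.east_extend_last, ← Walk.east_extend_last] at h2
        simp only [Walk.extend, Fin.snoc_init_self] at h2
        rw [if_pos (hP.trans hQ.symm)] at h2
        omega

/-! ### Expanding the operator powers -/

/-- Sums over odd indices, for a sequence vanishing at even indices. -/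
lemma sum_odd_eq_sum {M : Type*} [AddCommMonoid M] (f : ℕ → M) (hf : ∀ t, f (2 * t) = 0) (N : ℕ) :
    ∑ m ∈ range (2 * N), f m = ∑ t ∈ range N, f (2 * t + 1) := by
  induction N with
  | zero => simp
  | succ N ih => rw [mul_add_one, sum_range_succ, sum_range_succ, ih, hf, add_zero, sum_range_succ]

lemma add_pow_sub_sub_pow {R : Type*} [Ring R] {x y : R} (h : Commute x y) (k : ℕ) :
    (x + y) ^ k - (x - y) ^ k =
      ∑ t ∈ range (k + 1), 2 * ((k.choose (2 * t + 1) : R) * (y ^ (2 * t + 1) * x ^ (k - (2 * t + 1)))) := by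
  -- The factor 1 - (-1)^m is 0 for even m and 2 for odd m.
  set f : ℕ → R := fun m => (1 - (-1) ^ m) * ((k.choose m : R) * (y ^ m * x ^ (k - m))) with hf
  have h1 : (x + y) ^ k - (x - y) ^ k = ∑ m ∈ range (k + 1), f m := by
    rw [show x - y = -y + x by abel, add_comm x y, h.symm.add_pow, h.symm.neg_left.add_pow,
      ← sum_sub_distrib]
    refine sum_congr rfl fun m _ => ?_
    simp only [hf]
    rw [neg_pow, ← (Nat.cast_commute (k.choose m) _).eq, ← (Nat.cast_commute (k.choose m) _).eq,
      sub_mul, one_mul]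
    congr 1
    rw [mul_assoc, ← mul_assoc, (Nat.cast_commute (k.choose m) ((-1 : R) ^ m)).eq, mul_assoc]
  have h2 : ∑ m ∈ range (k + 1), f m = ∑ m ∈ range (2 * (k + 1)), f m := by
    refine sum_subset (range_subset_range.2 (by omega)) fun m _ hm => ?_
    have : k < m := by simpa using hm
    simp [hf, Nat.choose_eq_zero_of_lt this]
  rw [h1, h2, sum_odd_eq_sum f (fun t => by simp [hf])]
  refine sum_congr rfl fun t _ => ?_
  simp only [hf]
  rw [pow_succ (-1 : R), pow_mul]
  norm_num

lemma converge_pow_apply (j : ℕ) (f : ℤ × ℤ × ℤ → ℚ) (n r s : ℤ) :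
    (converge ^ j) f (n, r, s) = f (n - j, r, s - j) := by
  simp [converge, shift_pow]

lemma diverge_pow_apply (j : ℕ) (f : ℤ × ℤ × ℤ → ℚ) (n r s : ℤ) :
    (diverge ^ j) f (n, r, s) = f (n - j, r - j, s) := by
  simp [diverge, shift_pow]

lemma one_sub_converge_pow_apply (m : ℕ) (f : ℤ × ℤ × ℤ → ℚ) (n r s : ℤ) :
    ((1 - converge) ^ m) f (n, r, s) =
      ∑ j ∈ range (m + 1), (-1) ^ j * (m.choose j : ℚ) * f (n - j, r, s - j) := by
  have h : (1 - converge) ^ m =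
      ∑ j ∈ range (m + 1), ((-1 : ℚ) ^ j * (m.choose j : ℚ)) • converge ^ j := by
    rw [sub_eq_neg_add, ((Commute.one_right (-converge))).add_pow]
    refine sum_congr rfl fun j _ => ?_
    have hneg : (-converge) ^ j = ((-1 : ℚ) ^ j) • converge ^ j := by
      rw [← smul_pow, neg_one_smul]
    rw [hneg, one_pow, mul_one, ← (Nat.cast_commute (m.choose j) _).eq, mul_smul,
      Nat.cast_smul_eq_nsmul, ← nsmul_eq_mul, smul_comm]
  rw [h, LinearMap.sum_apply, Finset.sum_apply]
  simp [converge_pow_apply]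

/-- Pascal's rule reads (S+V) D = (1-C) D, but only at lengths above 1. Expanding (1-C)^m lowers the
length by at most m, so the bound on n keeps every use of the rule valid. -/
lemma straight_add_diverge_pow_disjointPairs (m : ℕ) {n : ℤ} (hn : m < n) (r s : ℤ) :
    ((straight + diverge) ^ m) disjointPairs (n, r, s) =
      ((1 - converge) ^ m) disjointPairs (n, r, s) := by
  have h0 : straight + diverge = meetOp 1 := by simp [meetOp]
  have hc : Commute (meetOp 1) (1 - converge) := by
    rw [← h0]
    exact (Commute.one_right _).sub_right
      (straight_commute_converge.add_left converge_commute_diverge.symm)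
  rw [h0]
  induction m generalizing n r s with
  | zero => simp
  | succ m ih =>
    have hn1 : (m : ℤ) < n - 1 := by push_cast at hn; omega
    rw [pow_succ', Module.End.mul_apply, meetOp_apply, ih hn1, ih hn1, ih hn1, ← meetOp_apply,
      ← Module.End.mul_apply, (hc.pow_right m).eq, Module.End.mul_apply, pow_succ,
      Module.End.mul_apply, one_sub_converge_pow_apply, one_sub_converge_pow_apply]
    refine sum_congr rfl fun j hj => ?_
    congr 1
    rw [mem_range] at hj
    rw [meetOp_apply, LinearMap.sub_apply, Pi.sub_apply, Module.End.one_apply,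
      disjointPairs_pascal (n := n - j) (by omega)]
    simp [converge]

lemma secondExpr_eq {n k : ℕ} (hk : k < n) (r s : ℕ) :
    secondExpr n k r s = (meetOp 0 ^ k) disjointPairs (n, r, s) := by
  have h : meetOp 0 = shift (1, 1, 1) + shift (1, 0, 0) := by
    simp [meetOp, straight, add_comm]
  rw [h, (shift_commute _ _).add_pow, LinearMap.sum_apply, Finset.sum_apply, secondExpr, mul_sum]
  refine sum_congr rfl fun j hj => ?_
  have hj' : j ≤ k := by rw [mem_range] at hj; omega
  rw [← (Nat.cast_commute (k.choose j) _).eq, ← nsmul_eq_mul, LinearMap.smul_apply, Pi.smul_apply,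
    Module.End.mul_apply, shift_pow, shift_pow, shift_apply, shift_apply]
  have e : ((n : ℤ), (r : ℤ), (s : ℤ)) - j • ((1 : ℤ), (1 : ℤ), (1 : ℤ)) -
      (k - j) • ((1 : ℤ), (0 : ℤ), (0 : ℤ)) = ((n : ℤ) - k, (r : ℤ) - j, (s : ℤ) - j) := by
    ext <;> simp
    omega
  rw [e, disjointPairs_of_pos (by omega), binom_natCast]
  push_cast
  rw [nsmul_eq_mul]
  ring

lemma firstExpr_eq {n k : ℕ} (hk : k < n) (r s : ℕ) :
    firstExpr n k r s = (meetOp 2 ^ k) disjointPairs (n, r, s) -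
      (meetOp 0 ^ k) disjointPairs (n, r, s) := by
  have hX : Commute (straight + diverge) diverge :=
    straight_commute_diverge.add_left (Commute.refl _)
  have h2 : meetOp 2 = (straight + diverge) + diverge := by
    rw [meetOp, two_smul, add_assoc]
  have h0 : meetOp 0 = (straight + diverge) - diverge := by simp [meetOp]
  have hsub : ((meetOp 2 ^ k) disjointPairs - (meetOp 0 ^ k) disjointPairs) (n, r, s) =
      (meetOp 2 ^ k - meetOp 0 ^ k) disjointPairs (n, r, s) := rfl
  rw [← Pi.sub_apply, hsub, h2, h0, add_pow_sub_sub_pow hX, LinearMap.sum_apply, Finset.sum_apply,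
    firstExpr, mul_sum]
  refine sum_congr rfl fun t _ => ?_
  have e1 : (2 : Module.End ℚ (ℤ × ℤ × ℤ → ℚ)) = ((2 : ℕ) : Module.End ℚ (ℤ × ℤ × ℤ → ℚ)) := by
    norm_cast
  rw [e1, ← nsmul_eq_mul, ← nsmul_eq_mul, LinearMap.smul_apply, Pi.smul_apply,
    LinearMap.smul_apply, Pi.smul_apply, Module.End.mul_apply, diverge_pow_apply,
    nsmul_eq_mul, nsmul_eq_mul]
  push_cast
  congr 1
  rw [show (2 * (t : ℤ) + 1) = ((2 * t + 1 : ℕ) : ℤ) by push_cast; ring, binom_natCast]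
  rcases Nat.lt_or_ge k (2 * t + 1) with h | h
  · simp [Nat.choose_eq_zero_of_lt h]
  obtain ⟨m, rfl⟩ := Nat.exists_eq_add_of_le h
  -- The power of V has shortened the length to n - (2t+1), which exceeds m = k - (2t+1) because k <
  -- n.
  rw [Nat.add_sub_cancel_left, straight_add_diverge_pow_disjointPairs m (by push_cast at *; omega),
    one_sub_converge_pow_apply, mul_sum]
  symm
  have hsub : range (m + 1) ⊆ range (2 * t + 1 + m + 1) := range_subset_range.2 (by omega)
  have em : ((2 * t + 1 + m : ℕ) : ℤ) - 1 - 2 * t = m := by push_cast; ring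
  rw [em]
  refine (sum_congr rfl fun j hj => ?_).trans (sum_subset hsub fun j _ hj => ?_)
  · rw [mem_range] at hj
    have e2 : (n : ℤ) - (2 * t + 1 : ℕ) - j = n - 1 - j - 2 * t := by push_cast; ring
    have e3 : (r : ℤ) - (2 * t + 1 : ℕ) = r - 1 - 2 * t := by push_cast; ring
    rw [e2, e3, disjointPairs_of_pos (by omega), binom_natCast]
    push_cast
    ring
  · have : m < j := by simpa using hj
    rw [binom_natCast, Nat.choose_eq_zero_of_lt this]
    simp

/-! ### From ordered counts to the theorem -/

/-- Distinct endpoints determine which walk comes first, so forgetting the order is injective. -/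
lemma ncard_unorderedPairs {n k r s : ℕ} (hrs : r < s) (A : Walk n → Walk n → Prop) :
    (unorderedPairs n k r s A).ncard =
      pairCount n (fun P Q => meetTimes P Q = k ∧ A P Q) r s := by
  classical
  rw [pairCount, ← Set.ncard_coe_finset]
  have h : unorderedPairs n k r s A = (fun p : Walk n × Walk n => s(p.1, p.2)) ''
      (({p : Walk n × Walk n | (p.1.east n = r ∧ p.2.east n = s) ∧
        (meetTimes p.1 p.2 = k ∧ A p.1 p.2)} : Finset (Walk n × Walk n)) :
          Set (Walk n × Walk n)) := by
    ext z
    simp only [unorderedPairs, Walk.terminal_eq_iff, meets_eq_meetTimes, Set.mem_ofPred_eq,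
      Set.mem_image, coe_filter, mem_univ, true_and, Prod.exists]
    constructor
    · rintro ⟨P, Q, rfl, h1, h2, h3, h4⟩
      exact ⟨P, Q, ⟨⟨h1, h2⟩, h3, h4⟩, rfl⟩
    · rintro ⟨P, Q, ⟨⟨h1, h2⟩, h3, h4⟩, rfl⟩
      exact ⟨P, Q, rfl, h1, h2, h3, h4⟩
  rw [h]
  convert Set.InjOn.ncard_image (f := fun p : Walk n × Walk n => s(p.1, p.2)) ?_
  rintro ⟨P, Q⟩ h1 ⟨P', Q'⟩ h2 h3
  simp only [coe_filter, mem_univ, true_and, Set.mem_ofPred_eq] at h1 h2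
  rcases Sym2.eq_iff.1 h3 with ⟨rfl, rfl⟩ | ⟨rfl, rfl⟩
  · rfl
  · have := h1.1.1.symm.trans h2.1.2
    omega

lemma pairCount_and_add_and_not {n : ℕ} (A B : Walk n → Walk n → Prop) (r s : ℤ) :
    pairCount n (fun P Q => A P Q ∧ B P Q) r s + pairCount n (fun P Q => A P Q ∧ ¬ B P Q) r s =
      pairCount n A r s := by
  classical
  unfold pairCount
  simp only [← and_assoc, ← filter_filter]
  exact card_filter_add_card_filter_not _

lemma meetFirst_iff_agreeTo {n k : ℕ} (hk : k ≤ n) (P Q : Walk n) :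
    MeetFirst k P Q ↔ AgreeTo k P Q :=
  forall_congr' fun _ => forall_congr' fun _ => forall_congr' fun hi =>
    P.pos_eq_iff Q (hi.trans hk)

/-- The index shift in `M` on the diagonal accounts for the common endpoint, which is a meeting but
not an interior one. -/
lemma M_eq_meetOp {n k r s : ℕ} (hk : k < n) (hrs : r ≤ s) :
    (M n k r s : ℚ) = (meetOp 2 ^ k) disjointPairs (n, r, s) := by
  classical
  rw [← pairCount_meetTimes n k (by exact_mod_cast hrs), M.eq_def]
  rcases lt_or_eq_of_le hrs with h | rfl
  · rw [if_neg h.ne, ncard_unorderedPairs h]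
    simp
  · rw [if_pos rfl]
    have hn : 0 < n := by omega
    rcases k with _ | k
    · rw [pairCount_eq_zero]
      intro P Q hP hQ h
      have := interiorMeets_add_one hn P Q hP hQ
      omega
    · rw [pairCount, ← Set.ncard_coe_finset]
      simp only [orderedCount, Walk.terminal_eq_iff]
      congr 2
      ext ⟨P, Q⟩
      simp only [Set.mem_ofPred_eq, coe_filter, mem_univ, true_and, and_assoc]
      refine and_congr_right fun hP => and_congr_right fun hQ => ?_
      rw [← interiorMeets_add_one hn P Q hP hQ]
      omega

end LatticePairs

theorem theorem2 (n k r s : ℕ) (hk : k < n) (hrs : r ≤ s) :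
    (LatticePairs.M n k r s : ℚ) =
      LatticePairs.firstExpr n k r s + LatticePairs.secondExpr n k r s ∧
    (r < s →
      ((LatticePairs.unorderedPairs n k r s
          (fun P Q => LatticePairs.MeetFirst k P Q)).ncard : ℚ) =
        LatticePairs.secondExpr n k r s ∧
      ((LatticePairs.unorderedPairs n k r s
          (fun P Q => ¬ LatticePairs.MeetFirst k P Q)).ncard : ℚ) =
        LatticePairs.firstExpr n k r s) ∧
    (LatticePairs.M n 0 r s : ℚ) =
      ((s : ℚ) - r) / n * (n.choose r : ℚ) * (n.choose s : ℚ) := by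
  open LatticePairs in
  have hrs' : (r : ℤ) ≤ s := by exact_mod_cast hrs
  refine ⟨?_, fun hlt => ?_, ?_⟩
  · rw [M_eq_meetOp hk hrs, firstExpr_eq hk, secondExpr_eq hk]
    ring
  · have h1 := pairCount_and_add_and_not (fun P Q : Walk n => meetTimes P Q = k) (AgreeTo k) r s
    have h2 := pairCount_meetTimes n k hrs'
    have h3 := pairCount_agreeTo hk.le hrs'
    rw [ncard_unorderedPairs hlt, ncard_unorderedPairs hlt, secondExpr_eq hk, firstExpr_eq hk]
    simp only [meetFirst_iff_agreeTo hk.le]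
    rw [← h2, ← h3, ← h1]
    push_cast
    exact ⟨rfl, by ring⟩
  · have hn : (0 : ℤ) < n := by omega
    rw [M_eq_meetOp (by omega) hrs, pow_zero, Module.End.one_apply, disjointPairs_of_pos hn,
      binom_natCast, binom_natCast]
    push_cast
    rfl
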